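/- Words are finite sequences over the positive integers $\mathbb{P}=\{1,2,3,\dots\}$ (the empty word is allowed), and $vw$ denotes concatenation. Two words are Knuth-equivalent, written $v\equiv w$, if one can be obtained from the other by a finite sequence of exchanges $xacby\leftrightarrow xcaby$ with $a\le b<c$ and $xbacy\leftrightarrow xbcay$ with $a<b\le c$, where $x,y$ are words and $a,b,c\in\mathbb{P}$. For a word $u$ let $C(u)=\{w \mid uw\equiv wu\}$ be its centralizer, and let $P(w)$ be the insertion tableau of $w$ under the Robinson–Schensted–Knuth row insertion. A singleton $a$-column is a column of length $1$ whose entry is $a$. Theorem. Let $w$ be a word over the positive integers, and let $12$ denote the two-letter word with letters $1,2$ in this order. Then $w\in C(12)$ if and only if the columns of $P(w)$ satisfy the following two conditions: (a) if $P(w)$ has a column of length $1$, then every column of length $1$ is a singleton $1$-column or a singleton $2$-column, and $P(w)$ has at least one singleton $1$-column and at least one singleton $2$-column; (b) every column of $P(w)$ of length at least $2$ contains both $1$ and $2$. -/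

import Mathlib

namespace Plactic

/-- A Knuth transposition between two words: `x a c b y ~ x c a b y` when `a ≤ b < c`, and
`x b a c y ~ x b c a y` when `a < b ≤ c`. -/
inductive KnuthStep {α : Type*} [LinearOrder α] : List α → List α → Prop
  | acb (x y : List α) (a b c : α) (hab : a ≤ b) (hbc : b < c) :
      KnuthStep (x ++ [a, c, b] ++ y) (x ++ [c, a, b] ++ y)
  | bac (x y : List α) (a b c : α) (hab : a < b) (hbc : b ≤ c) :
      KnuthStep (x ++ [b, a, c] ++ y) (x ++ [b, c, a] ++ y)

/-- Knuth equivalence of words: the equivalence relation generated by Knuth transpositions. -/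
def KnuthEquiv {α : Type*} [LinearOrder α] (v w : List α) : Prop :=
  Relation.EqvGen KnuthStep v w

/-- The centralizer `C(u)`: all words `w` such that `u w` is Knuth-equivalent to `w u`. -/
def centralizer {α : Type*} [LinearOrder α] (u : List α) : Set (List α) :=
  {w | KnuthEquiv (u ++ w) (w ++ u)}

/-- Row insertion of `x` into a row: `x` replaces the leftmost entry which is strictly larger
than `x`, and that entry is bumped out; if there is none, then `x` is put at the end of the row
and nothing is bumped. The result is the new row together with the bumped entry, if any. -/
def rowInsert {α : Type*} [LinearOrder α] (x : α) : List α → List α × Option α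
  | [] => ([x], none)
  | y :: ys =>
    if x < y then (x :: ys, some y)
    else (y :: (rowInsert x ys).1, (rowInsert x ys).2)

/-- RSK insertion of `x` into a tableau, given as the list of its rows from top to bottom:
`x` is inserted into the first row, and an entry bumped from a row is inserted into the next. -/
def tableauInsert {α : Type*} [LinearOrder α] (x : α) : List (List α) → List (List α)
  | [] => [[x]]
  | R :: Rs =>
    match rowInsert x R with
    | (R', none) => R' :: Rs
    | (R', some y) => R' :: tableauInsert y Rs

/-- The RSK insertion tableau `P(w)`, as the list of its rows from top to bottom: the letters
of `w` are inserted from left to right, starting with the empty tableau. -/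
def insertionTableau {α : Type*} [LinearOrder α] (w : List α) : List (List α) :=
  w.foldl (fun T x => tableauInsert x T) []

/-- The `j`-th column (counted from `0`) of a tableau, read from top to bottom. -/
def column {α : Type*} (T : List (List α)) (j : ℕ) : List α :=
  T.filterMap fun R => R[j]?

/-- The columns of a tableau, from left to right. There are as many of them as there are entries
in the first row. -/
def columns {α : Type*} (T : List (List α)) : List (List α) :=
  (List.range (T.headD []).length).map (column T)

/-- A singleton `a`-column is a column of length `1` whose entry is `a`. -/
def IsSingletonColumn {α : Type*} (a : α) (C : List α) : Prop :=
  C = [a]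

end Plactic

/-! By Knuth's theorem (`knuthEquiv_iff`), `w` commutes with `12` exactly when `12w` and `w12` have
the same insertion tableau, and both tableaux can be computed from that of `w`. Let `R` be the first
row of P(w), `T` the rows below it, and `S` the first row of `T`. Up to Knuth equivalence `w` is the
reading word of `T` followed by `R`. Every letter of `T` exceeds 1, so inserting that reading word
after `12` gives a tableau with first row `1 2 S` above the remaining rows of `T`; inserting `R`
into it yields P(12w). On the other side, P(w12) comes from inserting 1 and 2 into `R` and passing
the bumped letters on to `T`.

Write R = 1^a 2^b S₁ and S = 2^k S₂ with all letters of S₁ and S₂ greater than 2; column strictness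
gives k ≤ a. Comparing the first two rows of the results, mostly through their lengths, forces S₁
and S₂ to be empty and either a = k, b = 0 or k < a, 0 < b (`rowsCommute_of_insertion_eq`).
Conversely this suffices, whatever the lower rows are (`insertion_eq_of_rowsCommute`).
`column_conditions_iff` translates it into the conditions on columns. -/

namespace Plactic

/-! ### Row insertion and the Knuth relations -/

variable {α : Type*} [LinearOrder α]

/-- Successive row insertion of the letters of a word into a row: the resulting row and the word
of the bumped entries. -/
def rowInsertWord (R : List α) : List α → List α × List α
  | [] => (R, [])
  | x :: w =>
    ((rowInsertWord (rowInsert x R).1 w).1,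
      (rowInsert x R).2.toList ++ (rowInsertWord (rowInsert x R).1 w).2)

/-- Successive insertion of the letters of a word into a tableau. -/
def insertWord (T : List (List α)) (w : List α) : List (List α) :=
  w.foldl (fun T x => tableauInsert x T) T

theorem insertionTableau_append (u v : List α) :
    insertionTableau (u ++ v) = insertWord (insertionTableau u) v := by
  simp [insertionTableau, insertWord]

theorem insertWord_cons (R : List α) (Rs : List (List α)) (w : List α) :
    insertWord (R :: Rs) w = (rowInsertWord R w).1 :: insertWord Rs (rowInsertWord R w).2 := by
  induction w generalizing R Rs with
  | nil => rfl
  | cons x w ih =>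
    have h : insertWord (R :: Rs) (x :: w) = insertWord (tableauInsert x (R :: Rs)) w := rfl
    rw [h, tableauInsert, rowInsertWord]
    rcases hR : rowInsert x R with ⟨R', _ | y⟩
    · simp [ih]
    · simp only [ih, Option.toList_some, List.singleton_append]
      rfl

theorem insertWord_nil_cons (x : α) (w : List α) :
    insertWord [] (x :: w) =
      (rowInsertWord [] (x :: w)).1 :: insertWord [] (rowInsertWord [] (x :: w)).2 := by
  have h : insertWord [] (x :: w) = insertWord [[x]] w := rfl
  rw [h, insertWord_cons]
  rfl

theorem rowInsertWord_cons_of_le (y : α) (ys w : List α) (h : ∀ x ∈ w, y ≤ x) :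
    rowInsertWord (y :: ys) w = (y :: (rowInsertWord ys w).1, (rowInsertWord ys w).2) := by
  induction w generalizing ys with
  | nil => rfl
  | cons x w ih =>
    have hx : ¬ x < y := not_lt.2 (h x (by simp))
    simp only [rowInsertWord, rowInsert, if_neg hx]
    rw [ih _ fun z hz => h z (by simp [hz])]

/-- Once `x` has taken the first place, no later letter is small enough to bump it, so the rest of
the word only meets `ys`. Peeling off heads in this way drives most inductions below. -/
theorem rowInsertWord_cons_cons_of_lt {x y : α} (ys w : List α) (hxy : x < y)
    (h : ∀ z ∈ w, x ≤ z) :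
    rowInsertWord (y :: ys) (x :: w) =
      (x :: (rowInsertWord ys w).1, y :: (rowInsertWord ys w).2) := by
  simp only [rowInsertWord, rowInsert, if_pos hxy]
  rw [rowInsertWord_cons_of_le _ _ _ h]
  rfl

theorem rowInsert_spec (x : α) (R : List α) :
    ((∀ y ∈ R, y ≤ x) ∧ rowInsert x R = (R ++ [x], none)) ∨
      ∃ A z B, R = A ++ z :: B ∧ (∀ y ∈ A, y ≤ x) ∧ x < z ∧
        rowInsert x R = (A ++ x :: B, some z) := by
  induction R with
  | nil => left; simp [rowInsert]
  | cons y ys ih =>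
    by_cases h : x < y
    · right
      exact ⟨[], y, ys, by simp [rowInsert, h]⟩
    · rcases ih with ⟨h1, h2⟩ | ⟨A, z, B, rfl, h1, h2, h3⟩
      · left
        simp only [rowInsert, if_neg h, h2]
        simpa using ⟨not_lt.1 h, h1⟩
      · right
        refine ⟨y :: A, z, B, rfl, ?_, h2, by simp [rowInsert, h, h3]⟩
        simpa using ⟨not_lt.1 h, h1⟩

theorem pairwise_rowInsert {x : α} {R : List α} (hR : R.Pairwise (· ≤ ·)) :
    (rowInsert x R).1.Pairwise (· ≤ ·) := by
  rcases rowInsert_spec x R with ⟨h1, h2⟩ | ⟨A, z, B, rfl, h1, h2, h3⟩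
  · rw [h2]
    simp only [List.pairwise_append, List.pairwise_singleton, List.mem_singleton]
    exact ⟨hR, trivial, fun a ha b hb => hb ▸ h1 a ha⟩
  · rw [h3]
    simp only [List.pairwise_append, List.pairwise_cons, List.mem_cons] at hR ⊢
    obtain ⟨hA, ⟨hz, hB⟩, hAB⟩ := hR
    refine ⟨hA, ⟨fun b hb => h2.le.trans (hz b hb), hB⟩, ?_⟩
    rintro a ha b (rfl | hb)
    · exact h1 a ha
    · exact hAB a ha b (Or.inr hb)

theorem mem_rowInsert (x : α) (R : List α) : x ∈ (rowInsert x R).1 := by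
  rcases rowInsert_spec x R with ⟨-, h2⟩ | ⟨A, z, B, -, -, -, h3⟩
  · simp [h2]
  · simp [h3]

theorem mem_of_mem_rowInsert {x y : α} {R : List α} (h : y ∈ (rowInsert x R).1) :
    y = x ∨ y ∈ R := by
  rcases rowInsert_spec x R with ⟨-, h2⟩ | ⟨A, z, B, rfl, -, -, h3⟩
  · rw [h2] at h
    simpa [or_comm] using h
  · rw [h3] at h
    simp only [List.mem_append, List.mem_cons] at h ⊢
    tauto

theorem bumped_mem {x z : α} {R : List α} (h : (rowInsert x R).2 = some z) :
    x < z ∧ z ∈ R := by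
  rcases rowInsert_spec x R with ⟨-, h2⟩ | ⟨A, t, B, rfl, -, h2, h3⟩
  · simp [h2] at h
  · rw [h3] at h
    obtain rfl : t = z := by simpa using h
    exact ⟨h2, by simp⟩

theorem exists_bumped_le {b c : α} {R : List α} (hR : R.Pairwise (· ≤ ·)) (hc : c ∈ R)
    (hbc : b < c) : ∃ t, (rowInsert b R).2 = some t ∧ t ≤ c ∧ t ∈ R := by
  rcases rowInsert_spec b R with ⟨h1, -⟩ | ⟨A, t, B, rfl, h1, -, h3⟩
  · exact absurd (h1 c hc) (not_le.2 hbc)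
  · refine ⟨t, by rw [h3], ?_, by simp⟩
    simp only [List.pairwise_append, List.pairwise_cons] at hR
    simp only [List.mem_append, List.mem_cons] at hc
    rcases hc with hc | rfl | hc
    · exact absurd (h1 c hc) (not_le.2 hbc)
    · exact le_rfl
    · exact hR.2.1.1 c hc

theorem bumped_eq_none_of_le {b c : α} {R : List α} (hbc : b ≤ c)
    (h : (rowInsert b R).2 = none) : (rowInsert c (rowInsert b R).1).2 = none := by
  rcases rowInsert_spec b R with ⟨h1, h2⟩ | ⟨A, t, B, rfl, -, -, h3⟩
  · rcases rowInsert_spec c (rowInsert b R).1 with ⟨-, h4⟩ | ⟨A, t, B, h4, -, h5, -⟩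
    · rw [h4]
    · have ht : t ∈ (rowInsert b R).1 := by simp [h4]
      rcases mem_of_mem_rowInsert ht with rfl | ht
      · exact absurd hbc (not_le.2 h5)
      · exact absurd ((h1 t ht).trans hbc) (not_le.2 h5)
  · simp [h3] at h

theorem bumped_le_bumped {b c s z : α} {R : List α} (hR : R.Pairwise (· ≤ ·)) (hbc : b ≤ c)
    (h : (rowInsert b R).2 = some s) (h' : (rowInsert c (rowInsert b R).1).2 = some z) :
    s ≤ z := by
  obtain ⟨hcz, hz⟩ := bumped_mem h'
  rcases rowInsert_spec b R with ⟨h1, h2⟩ | ⟨A, t, B, rfl, h1, h2, h3⟩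
  · simp [h2] at h
  · rw [h3] at h hz
    obtain rfl : t = s := by simpa using h
    simp only [List.pairwise_append, List.pairwise_cons] at hR
    simp only [List.mem_append, List.mem_cons] at hz
    rcases hz with hz | rfl | hz
    · exact absurd ((h1 z hz).trans hbc) (not_le.2 hcz)
    · exact absurd hbc (not_le.2 hcz)
    · exact hR.2.1.1 z hz

/-- A Knuth transposition of three letters. -/
inductive KnuthTriple : List α → List α → Prop
  | acb (a b c : α) (hab : a ≤ b) (hbc : b < c) : KnuthTriple [a, c, b] [c, a, b]
  | bac (a b c : α) (hab : a < b) (hbc : b ≤ c) : KnuthTriple [b, a, c] [b, c, a]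

/-- A head `y ≤ a` is inert. Otherwise `a` bumps `y`, and the outcome depends on `c`: for `c < y`
the bumped words can differ by a relation of the other kind and in the reverse direction, for `y ≤
c` by one of the same kind. Hence the three alternatives. -/
theorem rowInsertWord_acb {a b c : α} (hab : a ≤ b) (hbc : b < c) {R : List α}
    (hR : R.Pairwise (· ≤ ·)) :
    (rowInsertWord R [a, c, b]).1 = (rowInsertWord R [c, a, b]).1 ∧
      ((rowInsertWord R [a, c, b]).2 = (rowInsertWord R [c, a, b]).2 ∨
        KnuthTriple (rowInsertWord R [a, c, b]).2 (rowInsertWord R [c, a, b]).2 ∨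
        KnuthTriple (rowInsertWord R [c, a, b]).2 (rowInsertWord R [a, c, b]).2) := by
  have hac := hab.trans_lt hbc
  induction R with
  | nil =>
    simp [rowInsertWord, rowInsert, hac, hab.not_gt, hac.not_gt, hbc]
  | cons y ys ih =>
    rw [List.pairwise_cons] at hR
    obtain ⟨hy, hys⟩ := hR
    rcases le_or_gt y a with hya | hay
    · rw [rowInsertWord_cons_of_le _ _ [a, c, b]
          (by simp [hya, hya.trans hab, hya.trans hac.le]),
        rowInsertWord_cons_of_le _ _ [c, a, b]
          (by simp [hya, hya.trans hab, hya.trans hac.le])]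
      simpa using ih hys
    · rw [rowInsertWord_cons_cons_of_lt ys [c, b] hay (by simp [hab, hac.le])]
      rcases lt_or_ge c y with hcy | hyc
      · cases ys with
        | nil =>
          simp [rowInsertWord, rowInsert, hac, hab.not_gt, hbc, hcy]
        | cons z zs =>
          have hyz : y ≤ z := hy z (by simp)
          have hcz := hcy.trans_le hyz
          simp only [rowInsertWord, rowInsert, hac, hab.not_gt, hbc, hcy, hcz, hbc.trans hcz,
            if_true, if_false, Option.toList_some, List.singleton_append, List.append_nil,
            true_and]
          right; right
          exact KnuthTriple.bac c y z hcy hyz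
      · obtain ⟨t, ht, htc, htm⟩ :=
          exists_bumped_le (b := b) (pairwise_rowInsert (x := c) hys) (mem_rowInsert c ys) hbc
        have hyt : y ≤ t := by
          rcases mem_of_mem_rowInsert htm with rfl | h
          · exact hyc
          · exact hy t h
        simp only [rowInsertWord, rowInsert, hyc.not_gt, hay, hab.not_gt, ht,
            if_true, if_false, Option.toList_some, List.singleton_append, List.append_nil,
            true_and]
        rcases hz : (rowInsert c ys).2 with _ | z
        · simp
        · right; left
          exact KnuthTriple.acb y t z hyt (htc.trans_lt (bumped_mem hz).1)

/-- Past the inert heads, one of `a`, `b` meets `y` first. The bumped words then agree or differ by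
a relation of the same kind, because weakly increasing letters bump weakly increasing entries. -/
theorem rowInsertWord_bac {a b c : α} (hab : a < b) (hbc : b ≤ c) {R : List α}
    (hR : R.Pairwise (· ≤ ·)) :
    (rowInsertWord R [b, a, c]).1 = (rowInsertWord R [b, c, a]).1 ∧
      ((rowInsertWord R [b, a, c]).2 = (rowInsertWord R [b, c, a]).2 ∨
        KnuthTriple (rowInsertWord R [b, a, c]).2 (rowInsertWord R [b, c, a]).2 ∨
        KnuthTriple (rowInsertWord R [b, c, a]).2 (rowInsertWord R [b, a, c]).2) := by
  have hac := hab.trans_le hbc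
  induction R with
  | nil =>
    simp [rowInsertWord, rowInsert, hab, hac.not_gt, hbc.not_gt]
  | cons y ys ih =>
    rw [List.pairwise_cons] at hR
    obtain ⟨hy, hys⟩ := hR
    rcases le_or_gt y a with hya | hay
    · rw [rowInsertWord_cons_of_le _ _ [b, a, c]
          (by simp [hya, hya.trans hab.le, hya.trans hac.le]),
        rowInsertWord_cons_of_le _ _ [b, c, a]
          (by simp [hya, hya.trans hab.le, hya.trans hac.le])]
      simpa using ih hys
    · rcases lt_or_ge b y with hby | hyb
      · simp only [rowInsertWord, rowInsert, hab, hby, hac.not_gt, hbc.not_gt,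
            if_true, if_false, Option.toList_some, List.singleton_append, List.append_nil,
            true_and]
        rcases hz : (rowInsert c ys).2 with _ | z
        · simp
        · right; left
          exact KnuthTriple.bac b y z hby (hy z (bumped_mem hz).2)
      · simp only [rowInsertWord, rowInsert, hay, hyb.not_gt, (hyb.trans hbc).not_gt, hac.not_gt,
            if_true, if_false, Option.toList_some, List.singleton_append, List.append_nil,
            true_and]
        rcases hs : (rowInsert b ys).2 with _ | s
        · simp [bumped_eq_none_of_le hbc hs]
        · rcases hz : (rowInsert c (rowInsert b ys).1).2 with _ | z
          · simp
          · right; left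
            exact KnuthTriple.bac y s z (hyb.trans_lt (bumped_mem hs).1)
              (bumped_le_bumped hys hbc hs hz)

theorem KnuthTriple.rowInsertWord {u v : List α} (h : KnuthTriple u v) {R : List α}
    (hR : R.Pairwise (· ≤ ·)) :
    (rowInsertWord R u).1 = (rowInsertWord R v).1 ∧
      ((rowInsertWord R u).2 = (rowInsertWord R v).2 ∨
        KnuthTriple (rowInsertWord R u).2 (rowInsertWord R v).2 ∨
        KnuthTriple (rowInsertWord R v).2 (rowInsertWord R u).2) := by
  cases h with
  | acb a b c hab hbc => exact rowInsertWord_acb hab hbc hR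
  | bac a b c hab hbc => exact rowInsertWord_bac hab hbc hR

/-- The top rows agree, and the words passed down are again equal or a Knuth triple in one of the
two directions, so induction on the rows applies. -/
theorem KnuthTriple.insertWord_eq {T : List (List α)} (hT : ∀ R ∈ T, R.Pairwise (· ≤ ·))
    {u v : List α} (h : KnuthTriple u v) : insertWord T u = insertWord T v := by
  induction T generalizing u v with
  | nil =>
    cases h with
    | acb a b c hab hbc =>
      simp [insertWord, tableauInsert, rowInsert, hab.not_gt, hbc,
        (hab.trans_lt hbc).not_gt, hab.trans_lt hbc]
    | bac a b c hab hbc =>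
      simp [insertWord, tableauInsert, rowInsert, hab, hbc.not_gt,
        (hab.trans_le hbc).not_gt]
  | cons R Rs ih =>
    have ih' := fun {u v : List α} => ih (fun S hS => hT S (by simp [hS])) (u := u) (v := v)
    obtain ⟨h1, h2⟩ := h.rowInsertWord (hT R (by simp))
    rw [insertWord_cons, insertWord_cons, h1]
    rcases h2 with h2 | h2 | h2
    · rw [h2]
    · rw [ih' h2]
    · rw [ih' h2]

theorem pairwise_tableauInsert {T : List (List α)} (hT : ∀ R ∈ T, R.Pairwise (· ≤ ·)) (x : α) :
    ∀ R ∈ tableauInsert x T, R.Pairwise (· ≤ ·) := by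
  induction T generalizing x with
  | nil => simp [tableauInsert]
  | cons R Rs ih =>
    have hR := pairwise_rowInsert (x := x) (hT R (by simp))
    have hRs : ∀ S ∈ Rs, S.Pairwise (· ≤ ·) := fun S hS => hT S (by simp [hS])
    rw [tableauInsert]
    rcases h : rowInsert x R with ⟨R', _ | y⟩ <;> rw [h] at hR
    · simpa using ⟨hR, hRs⟩
    · simpa using ⟨hR, ih hRs y⟩

theorem pairwise_insertionTableau (w : List α) :
    ∀ R ∈ insertionTableau w, R.Pairwise (· ≤ ·) := by
  induction w using List.reverseRecOn with
  | nil => simp [insertionTableau]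
  | append_singleton w x ih =>
    rw [insertionTableau_append]
    exact pairwise_tableauInsert ih x

/-- Knuth-equivalent words have the same insertion tableau. -/
theorem KnuthEquiv.insertionTableau_eq {v w : List α} (h : KnuthEquiv v w) :
    insertionTableau v = insertionTableau w := by
  induction h with
  | rel v w h =>
    cases h with
    | acb x y a b c hab hbc =>
      rw [insertionTableau_append, insertionTableau_append, insertionTableau_append,
        insertionTableau_append,
        (KnuthTriple.acb a b c hab hbc).insertWord_eq (pairwise_insertionTableau x)]
    | bac x y a b c hab hbc =>
      rw [insertionTableau_append, insertionTableau_append, insertionTableau_append,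
        insertionTableau_append,
        (KnuthTriple.bac a b c hab hbc).insertWord_eq (pairwise_insertionTableau x)]
  | refl => rfl
  | symm _ _ _ ih => exact ih.symm
  | trans _ _ _ _ _ ih ih' => exact ih.trans ih'

end Plactic

/-! ### Reading words and Knuth's theorem -/

namespace Plactic

/-- The row reading word of a tableau: its rows from bottom to top. -/
def rowReading {α : Type*} (T : List (List α)) : List α := T.reverse.flatten

@[simp]
theorem rowReading_nil {α : Type*} : rowReading ([] : List (List α)) = [] := rfl

@[simp]
theorem rowReading_cons {α : Type*} (R : List α) (T : List (List α)) :
    rowReading (R :: T) = rowReading T ++ R := by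
  simp [rowReading]

variable {α : Type*} [LinearOrder α]

theorem KnuthEquiv.refl (u : List α) : KnuthEquiv u u := Relation.EqvGen.refl u

theorem KnuthEquiv.symm {u v : List α} (h : KnuthEquiv u v) : KnuthEquiv v u :=
  Relation.EqvGen.symm _ _ h

theorem KnuthEquiv.trans {u v w : List α} (h : KnuthEquiv u v) (h' : KnuthEquiv v w) :
    KnuthEquiv u w :=
  Relation.EqvGen.trans _ _ _ h h'

theorem KnuthEquiv.append {u v : List α} (h : KnuthEquiv u v) (p q : List α) :
    KnuthEquiv (p ++ u ++ q) (p ++ v ++ q) := by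
  induction h with
  | rel u v h =>
    refine Relation.EqvGen.rel _ _ ?_
    cases h with
    | acb x y a b c hab hbc =>
      simpa using KnuthStep.acb (p ++ x) (y ++ q) a b c hab hbc
    | bac x y a b c hab hbc =>
      simpa using KnuthStep.bac (p ++ x) (y ++ q) a b c hab hbc
  | refl => exact KnuthEquiv.refl _
  | symm _ _ _ ih => exact ih.symm
  | trans _ _ _ _ _ ih ih' => exact ih.trans ih'

theorem KnuthEquiv.append_left {u v : List α} (h : KnuthEquiv u v) (p : List α) :
    KnuthEquiv (p ++ u) (p ++ v) := by
  simpa using h.append p []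

theorem KnuthEquiv.append_right {u v : List α} (h : KnuthEquiv u v) (q : List α) :
    KnuthEquiv (u ++ q) (v ++ q) := by
  simpa using h.append [] q

theorem KnuthEquiv.acb {a b c : α} (y : List α) (hab : a ≤ b) (hbc : b < c) :
    KnuthEquiv (a :: c :: b :: y) (c :: a :: b :: y) :=
  Relation.EqvGen.rel _ _ (KnuthStep.acb [] y a b c hab hbc)

theorem KnuthEquiv.bac {a b c : α} (y : List α) (hab : a < b) (hbc : b ≤ c) :
    KnuthEquiv (b :: a :: c :: y) (b :: c :: a :: y) :=
  Relation.EqvGen.rel _ _ (KnuthStep.bac [] y a b c hab hbc)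

theorem knuthEquiv_cons_append_singleton {x z : α} {B : List α} (hxz : x < z)
    (hB : (z :: B).Pairwise (· ≤ ·)) : KnuthEquiv (z :: B ++ [x]) (z :: x :: B) := by
  induction B generalizing z with
  | nil => exact KnuthEquiv.refl _
  | cons b B ih =>
    rw [List.pairwise_cons] at hB
    have hzb := hB.1 b (by simp)
    exact ((ih (hxz.trans_le hzb) hB.2).append_left [z]).trans (KnuthEquiv.bac B hxz hzb).symm

theorem knuthEquiv_append_cons_cons {x z : α} {A : List α} (hxz : x < z)
    (hA : (A ++ [x]).Pairwise (· ≤ ·)) : KnuthEquiv (A ++ [z, x]) (z :: A ++ [x]) := by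
  induction A with
  | nil => exact KnuthEquiv.refl _
  | cons a A ih =>
    rw [List.cons_append, List.pairwise_cons] at hA
    refine ((ih hA.2).append_left [a]).trans ?_
    cases A with
    | nil => exact KnuthEquiv.acb [] (hA.1 x (by simp)) hxz
    | cons b A =>
      refine KnuthEquiv.acb (A ++ [x]) (hA.1 b (by simp)) (lt_of_le_of_lt ?_ hxz)
      exact (List.pairwise_cons.1 hA.2).1 x (by simp)

/-- With R = A z B and `z` the bumped entry, `x` first travels left through `B` by `bac` relations
until it stands just after `z`; then `z` travels left through `A` by `acb` relations, each using the
next letter as witness. -/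
theorem knuthEquiv_rowInsert (x : α) {R : List α} (hR : R.Pairwise (· ≤ ·)) :
    KnuthEquiv (R ++ [x]) ((rowInsert x R).2.toList ++ (rowInsert x R).1) := by
  have hR' := pairwise_rowInsert (x := x) hR
  rcases rowInsert_spec x R with ⟨-, h⟩ | ⟨A, z, B, rfl, -, hxz, h⟩
  · rw [h]
    exact KnuthEquiv.refl _
  · rw [h] at hR' ⊢
    have hB := (List.pairwise_append.1 hR).2.1
    have hA : (A ++ [x]).Pairwise (· ≤ ·) := hR'.sublist (by simp)
    have h1 := (knuthEquiv_cons_append_singleton hxz hB).append_left A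
    have h2 := (knuthEquiv_append_cons_cons hxz hA).append_right B
    simp only [List.append_assoc, List.cons_append, List.nil_append, Option.toList_some]
      at h1 h2 ⊢
    exact h1.trans h2

theorem knuthEquiv_rowReading_tableauInsert {T : List (List α)}
    (hT : ∀ R ∈ T, R.Pairwise (· ≤ ·)) (x : α) :
    KnuthEquiv (rowReading T ++ [x]) (rowReading (tableauInsert x T)) := by
  induction T generalizing x with
  | nil => exact KnuthEquiv.refl _
  | cons R Rs ih =>
    have hR := (knuthEquiv_rowInsert x (hT R (by simp))).append_left (rowReading Rs)
    rw [tableauInsert]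
    rcases h : rowInsert x R with ⟨R', _ | y⟩ <;> rw [h] at hR
    · simpa using hR
    · have h2 := (ih (fun S hS => hT S (by simp [hS])) y).append_right R'
      simp only [rowReading_cons, Option.toList_some, List.append_assoc] at hR h2 ⊢
      exact hR.trans h2

/-- Every word is Knuth-equivalent to the row reading word of its insertion tableau. -/
theorem knuthEquiv_rowReading_insertionTableau (w : List α) :
    KnuthEquiv w (rowReading (insertionTableau w)) := by
  induction w using List.reverseRecOn with
  | nil => exact KnuthEquiv.refl _
  | append_singleton w x ih =>
    rw [insertionTableau_append]
    exact (ih.append_right [x]).trans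
      (knuthEquiv_rowReading_tableauInsert (pairwise_insertionTableau w) x)

/-- Knuth's theorem. -/
theorem knuthEquiv_iff (v w : List α) :
    KnuthEquiv v w ↔ insertionTableau v = insertionTableau w := by
  refine ⟨fun h => h.insertionTableau_eq, fun h => ?_⟩
  have h' := knuthEquiv_rowReading_insertionTableau v
  rw [h] at h'
  exact h'.trans (knuthEquiv_rowReading_insertionTableau w).symm

/-! ### Semistandard tableaux -/

/-- The second row can be put below the first one: it is not longer, and the entries in each
column increase strictly. -/
def ColumnStrict : List α → List α → Prop
  | _, [] => True
  | [], _ :: _ => False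
  | a :: R, b :: S => a < b ∧ ColumnStrict R S

@[simp]
theorem columnStrict_nil (R : List α) : ColumnStrict R [] := by
  cases R <;> trivial

@[simp]
theorem not_columnStrict_nil (b : α) (S : List α) : ¬ ColumnStrict [] (b :: S) := id

theorem ColumnStrict.exists_lt {R S : List α} (h : ColumnStrict R S) {j : ℕ} {s : α}
    (hs : S[j]? = some s) : ∃ r, R[j]? = some r ∧ r < s := by
  induction S generalizing R j with
  | nil => simp at hs
  | cons b S ih =>
    cases R with
    | nil => exact absurd h (not_columnStrict_nil b S)
    | cons a R =>
      cases j with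
      | zero =>
        obtain rfl : b = s := by simpa using hs
        exact ⟨a, rfl, h.1⟩
      | succ j => simpa using ih h.2 (by simpa using hs)

theorem ColumnStrict.length_le {R S : List α} (h : ColumnStrict R S) :
    S.length ≤ R.length := by
  by_contra! hlt
  obtain ⟨r, hr, -⟩ := h.exists_lt (List.getElem?_eq_getElem hlt)
  simp at hr

theorem ColumnStrict.rowInsert_left {R S : List α} (h : ColumnStrict R S) (x : α) :
    ColumnStrict (rowInsert x R).1 S := by
  induction R generalizing S with
  | nil =>
    cases S with
    | nil => simp
    | cons s S => exact absurd h (not_columnStrict_nil s S)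
  | cons r R ih =>
    cases S with
    | nil => simp
    | cons s S =>
      rw [rowInsert]
      split_ifs with hx
      · exact ⟨hx.trans h.1, h.2⟩
      · exact ⟨h.1, ih h.2⟩

/-- The entry below `z` exceeds `z`, so `z` enters the next row no further right than the column it
left; the entries above that place are smaller than `z`. -/
theorem ColumnStrict.rowInsert_bumped {R S : List α} (h : ColumnStrict R S) {x z : α}
    (hz : (rowInsert x R).2 = some z) : ColumnStrict (rowInsert x R).1 (rowInsert z S).1 := by
  induction R generalizing S with
  | nil => simp [rowInsert] at hz
  | cons r R ih =>
    rw [rowInsert] at hz ⊢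
    split_ifs at hz ⊢ with hx
    · obtain rfl : r = z := by simpa using hz
      cases S with
      | nil => exact ⟨hx, columnStrict_nil _⟩
      | cons s S =>
        rw [rowInsert, if_pos h.1]
        exact ⟨hx, h.2⟩
    · have hrz : r < z := (not_lt.1 hx).trans_lt (bumped_mem hz).1
      cases S with
      | nil => exact ⟨hrz, columnStrict_nil _⟩
      | cons s S =>
        rw [rowInsert]
        split_ifs with hs
        · exact ⟨hrz, h.2.rowInsert_left x⟩
        · exact ⟨h.1, ih h.2 hz⟩

/-- Semistandard tableaux, given as the list of their rows from top to bottom. -/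
def IsTableau : List (List α) → Prop
  | [] => True
  | R :: T => R ≠ [] ∧ R.Pairwise (· ≤ ·) ∧ ColumnStrict R (T.headD []) ∧ IsTableau T

theorem rowInsert_ne_nil (x : α) (R : List α) : (rowInsert x R).1 ≠ [] :=
  List.ne_nil_of_mem (mem_rowInsert x R)

theorem headD_tableauInsert (z : α) (T : List (List α)) :
    (tableauInsert z T).headD [] = (rowInsert z (T.headD [])).1 := by
  cases T with
  | nil => rfl
  | cons S T =>
    rw [tableauInsert]
    rcases h : rowInsert z S with ⟨S', _ | y⟩ <;> simp [h]

theorem IsTableau.tableauInsert {T : List (List α)} (hT : IsTableau T) (x : α) :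
    IsTableau (tableauInsert x T) := by
  induction T generalizing x with
  | nil => simp [Plactic.tableauInsert, IsTableau]
  | cons R T ih =>
    obtain ⟨-, hR, hRT, hT⟩ := hT
    have h1 := rowInsert_ne_nil x R
    have h2 := pairwise_rowInsert (x := x) hR
    have h3 := hRT.rowInsert_left x
    have h4 := fun z => hRT.rowInsert_bumped (x := x) (z := z)
    rw [Plactic.tableauInsert]
    rcases h : rowInsert x R with ⟨R', _ | y⟩ <;> simp only [h] at h1 h2 h3 h4
    · exact ⟨h1, h2, h3, hT⟩
    · refine ⟨h1, h2, ?_, ih hT y⟩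
      rw [headD_tableauInsert]
      exact h4 y rfl

theorem isTableau_insertionTableau (w : List α) : IsTableau (insertionTableau w) := by
  induction w using List.reverseRecOn with
  | nil => trivial
  | append_singleton w x ih =>
    rw [insertionTableau_append]
    exact ih.tableauInsert x

theorem rowInsertWord_nil_left {R : List α} (hR : R.Pairwise (· ≤ ·)) :
    rowInsertWord [] R = (R, []) := by
  induction R with
  | nil => rfl
  | cons r R ih =>
    rw [List.pairwise_cons] at hR
    simp only [rowInsertWord, rowInsert]
    rw [rowInsertWord_cons_of_le _ _ _ hR.1, ih hR.2]
    rfl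

/-- Each letter of `R` bumps exactly the entry below it in its own column, and the letters of `R`
beyond the end of `S` are appended. -/
theorem ColumnStrict.rowInsertWord_eq {R S : List α} (h : ColumnStrict R S)
    (hR : R.Pairwise (· ≤ ·)) : rowInsertWord S R = (R, S) := by
  induction S generalizing R with
  | nil => exact rowInsertWord_nil_left hR
  | cons s S ih =>
    cases R with
    | nil => exact absurd h (not_columnStrict_nil s S)
    | cons r R =>
      rw [List.pairwise_cons] at hR
      rw [rowInsertWord_cons_cons_of_lt _ _ h.1 hR.1, ih h.2 hR.2]

/-- Inserting the first row of a tableau into the remaining rows gives the tableau back. -/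
theorem IsTableau.insertWord_eq {R : List α} {T : List (List α)} (h : IsTableau (R :: T)) :
    insertWord T R = R :: T := by
  induction T generalizing R with
  | nil =>
    obtain ⟨hne, hR, -⟩ := h
    cases R with
    | nil => exact absurd rfl hne
    | cons r R =>
      rw [insertWord_nil_cons, rowInsertWord_nil_left hR]
      rfl
  | cons S T ih =>
    obtain ⟨-, hR, hRS, hT⟩ := h
    rw [insertWord_cons, ColumnStrict.rowInsertWord_eq (S := S) hRS hR, ih hT]

theorem IsTableau.insertionTableau_rowReading {T : List (List α)} (hT : IsTableau T) :
    insertionTableau (rowReading T) = T := by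
  induction T with
  | nil => rfl
  | cons R T ih =>
    rw [rowReading_cons, insertionTableau_append, ih hT.2.2.2, hT.insertWord_eq]

/-! ### Lengths and letters under row insertion -/

theorem length_rowInsert (x : α) (R : List α) :
    (rowInsert x R).1.length + (rowInsert x R).2.toList.length = R.length + 1 := by
  rcases rowInsert_spec x R with ⟨-, h⟩ | ⟨A, z, B, rfl, -, -, h⟩ <;> simp [h]

theorem length_rowInsertWord (R w : List α) :
    (rowInsertWord R w).1.length + (rowInsertWord R w).2.length = R.length + w.length := by
  induction w generalizing R with
  | nil => simp [rowInsertWord]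
  | cons x w ih =>
    have h1 := ih (rowInsert x R).1
    have h2 := length_rowInsert x R
    simp only [rowInsertWord, List.length_append, List.length_cons]
    omega

/-- The letters of a weakly increasing word settle in distinct places, since none of them bumps
another. -/
theorem length_le_length_rowInsertWord (R : List α) {w : List α} (hw : w.Pairwise (· ≤ ·)) :
    w.length ≤ (rowInsertWord R w).1.length := by
  induction R generalizing w with
  | nil => rw [rowInsertWord_nil_left hw]
  | cons r R ih =>
    cases w with
    | nil => simp
    | cons x w =>
      have hw' := List.pairwise_cons.1 hw
      rcases lt_or_ge x r with hx | hx
      · rw [rowInsertWord_cons_cons_of_lt _ _ hx hw'.1]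
        simpa using ih hw'.2
      · rw [rowInsertWord_cons_of_le _ _ _ (by
          simpa using ⟨hx, fun a ha => hx.trans (hw'.1 a ha)⟩)]
        exact (ih hw).trans (by simp)

theorem mem_of_mem_rowInsertWord {R w : List α} {y : α} (h : y ∈ (rowInsertWord R w).1) :
    y ∈ R ∨ y ∈ w := by
  induction w generalizing R with
  | nil => exact Or.inl h
  | cons x w ih =>
    rcases ih h with h | h
    · rcases mem_of_mem_rowInsert h with rfl | h <;> simp_all
    · simp [h]

theorem headD_insertWord (T : List (List α)) (w : List α) :
    (insertWord T w).headD [] = (rowInsertWord (T.headD []) w).1 := by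
  cases T with
  | nil =>
    cases w with
    | nil => rfl
    | cons x w => simp [insertWord_nil_cons]
  | cons R T => simp [insertWord_cons]

theorem rowInsertWord_append_of_le {P u : List α} (Z : List α) (h : ∀ y ∈ P, ∀ x ∈ u, y ≤ x) :
    rowInsertWord (P ++ Z) u = (P ++ (rowInsertWord Z u).1, (rowInsertWord Z u).2) := by
  induction P with
  | nil => rfl
  | cons y P ih =>
    rw [List.cons_append, rowInsertWord_cons_of_le _ _ _ (h y (by simp)),
      ih fun z hz => h z (by simp [hz])]
    rfl

theorem insertWord_singleton_append {P u : List α} (h : ∀ y ∈ P, ∀ x ∈ u, y ≤ x) :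
    insertWord [P] u = (P ++ (insertionTableau u).headD []) :: (insertionTableau u).tail := by
  have h0 : insertionTableau u = insertWord [] u := rfl
  have key := rowInsertWord_append_of_le [] h
  rw [List.append_nil] at key
  rw [insertWord_cons, key, h0]
  cases u with
  | nil => simp [rowInsertWord, insertWord]
  | cons x u => simp [insertWord_nil_cons]

theorem rowInsertWord_replicate_append {x y : α} (hxy : x < y) (m : ℕ) (Z : List α) {u : List α}
    (hu : ∀ z ∈ u, x ≤ z) :
    rowInsertWord (List.replicate m y ++ Z) (List.replicate m x ++ u) =
      (List.replicate m x ++ (rowInsertWord Z u).1,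
        List.replicate m y ++ (rowInsertWord Z u).2) := by
  induction m with
  | zero => simp
  | succ m ih =>
    rw [List.replicate_succ, List.replicate_succ, List.cons_append, List.cons_append,
      rowInsertWord_cons_cons_of_lt _ _ hxy, ih]
    · rfl
    · intro z hz
      rcases List.mem_append.1 hz with hz | hz
      · exact (List.eq_of_mem_replicate hz).ge
      · exact hu z hz

end Plactic

/-! ### Multiplication by 12 on either side -/

namespace Plactic

/-- A weakly increasing word bumps entries from left to right. In particular, what it bumps from a
row is again weakly increasing. -/
theorem sublist_rowInsertWord {α : Type*} [LinearOrder α] (R : List α) {w : List α}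
    (hw : w.Pairwise (· ≤ ·)) : (rowInsertWord R w).2.Sublist R := by
  induction R generalizing w with
  | nil => rw [rowInsertWord_nil_left hw]
  | cons r R ih =>
    cases w with
    | nil => simp [rowInsertWord]
    | cons x w =>
      have hw' := List.pairwise_cons.1 hw
      rcases lt_or_ge x r with hx | hx
      · rw [rowInsertWord_cons_cons_of_lt _ _ hx hw'.1]
        exact (ih hw'.2).cons_cons r
      · rw [rowInsertWord_cons_of_le _ _ _ (by
          simpa using ⟨hx, fun a ha => hx.trans (hw'.1 a ha)⟩)]
        exact (ih hw).cons r

theorem exists_eq_replicate_append {α : Type*} [LinearOrder α] {x : α} {R : List α}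
    (hR : R.Pairwise (· ≤ ·)) (hx : ∀ y ∈ R, x ≤ y) :
    ∃ n S, R = List.replicate n x ++ S ∧ S.Pairwise (· ≤ ·) ∧ ∀ y ∈ S, x < y := by
  induction R with
  | nil => exact ⟨0, [], by simp⟩
  | cons r R ih =>
    have hR' := List.pairwise_cons.1 hR
    rcases (hx r (by simp)).eq_or_lt with rfl | hr
    · obtain ⟨n, S, rfl, h⟩ := ih hR'.2 fun y hy => hx y (by simp [hy])
      exact ⟨n + 1, S, by simp [List.replicate_succ], h⟩
    · refine ⟨0, r :: R, by simp, hR, ?_⟩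
      intro y hy
      rcases List.mem_cons.1 hy with rfl | hy
      · exact hr
      · exact hr.trans_le (hR'.1 y hy)

theorem IsTableau.exists_lt_of_mem_rowReading {α : Type*} [LinearOrder α] {R : List α}
    {T : List (List α)} (h : IsTableau (R :: T)) {x : α} (hx : x ∈ rowReading T) :
    ∃ r ∈ R, r < x := by
  induction T generalizing R with
  | nil => simp at hx
  | cons S T ih =>
    obtain ⟨-, -, hRS, hT⟩ := h
    have key : ∀ s ∈ S, ∃ r ∈ R, r < s := by
      intro s hs
      obtain ⟨j, hj⟩ := List.mem_iff_getElem?.1 hs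
      obtain ⟨r, hr, hrs⟩ := ColumnStrict.exists_lt (S := S) hRS hj
      exact ⟨r, List.mem_of_getElem? hr, hrs⟩
    rw [rowReading_cons, List.mem_append] at hx
    rcases hx with hx | hx
    · obtain ⟨s, hs, hsx⟩ := ih hT hx
      obtain ⟨r, hr, hrs⟩ := key s hs
      exact ⟨r, hr, hrs.trans hsx⟩
    · exact key x hx

theorem replicate_append_cons_self {α : Type*} (n : ℕ) (x : α) (Z : List α) :
    List.replicate n x ++ x :: Z = x :: (List.replicate n x ++ Z) := by
  rw [← List.cons_append, ← List.replicate_succ, List.replicate_succ']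
  simp

theorem two_le_of_one_lt {x : ℕ+} (h : 1 < x) : 2 ≤ x := PNat.add_one_le_iff.2 h

theorem one_lt_of_mem_rowReading {R : List ℕ+} {T : List (List ℕ+)} (h : IsTableau (R :: T))
    {x : ℕ+} (hx : x ∈ rowReading T) : 1 < x := by
  obtain ⟨r, -, hr⟩ := h.exists_lt_of_mem_rowReading hx
  exact (one_le).trans_lt hr

/-- Replace `w` by the reading word of `T` followed by `R`. The letters of `T` are at least 2, so
they never disturb the row `1 2`, and the first row of `T` is built to its right. -/
theorem insertionTableau_one_two_append {w R : List ℕ+} {T : List (List ℕ+)}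
    (h : insertionTableau w = R :: T) :
    insertionTableau ([1, 2] ++ w) =
      (rowInsertWord (1 :: 2 :: T.headD []) R).1 ::
        insertWord T.tail (rowInsertWord (1 :: 2 :: T.headD []) R).2 := by
  have hT : IsTableau (R :: T) := h ▸ isTableau_insertionTableau w
  have h1 := ((knuthEquiv_rowReading_insertionTableau w).append_left [1, 2]).insertionTableau_eq
  have h12 : insertionTableau ([1, 2] : List ℕ+) = [[1, 2]] := by
    simp [insertionTableau, tableauInsert, rowInsert]
  rw [h1, h, rowReading_cons, ← List.append_assoc, insertionTableau_append,
    insertionTableau_append, h12, insertWord_singleton_append,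
    hT.2.2.2.insertionTableau_rowReading, insertWord_cons]
  · rfl
  · intro y hy x hx
    have hx := two_le_of_one_lt (one_lt_of_mem_rowReading hT hx)
    simp only [List.mem_cons, List.not_mem_nil, or_false] at hy
    rcases hy with rfl | rfl
    · exact one_le
    · exact hx

theorem insertionTableau_append_one_two {w R : List ℕ+} {T : List (List ℕ+)}
    (h : insertionTableau w = R :: T) :
    insertionTableau (w ++ [1, 2]) =
      (rowInsertWord R [1, 2]).1 :: insertWord T (rowInsertWord R [1, 2]).2 := by
  rw [insertionTableau_append, h, insertWord_cons]

theorem rowInsertWord_one_two_cons (a k : ℕ) (S V : List ℕ+) (hka : k ≤ a) :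
    rowInsertWord (1 :: 2 :: (List.replicate k 2 ++ S)) (List.replicate a 1 ++ V) =
      (1 :: (List.replicate k 1 ++ (rowInsertWord (2 :: S) (List.replicate (a - k) 1 ++ V)).1),
        List.replicate k 2 ++ (rowInsertWord (2 :: S) (List.replicate (a - k) 1 ++ V)).2) := by
  obtain ⟨d, rfl⟩ := Nat.exists_eq_add_of_le hka
  rw [rowInsertWord_cons_of_le _ _ _ fun x _ => one_le]
  -- The 2 of `12` is moved behind the `k` equal letters: then `k` ones bump `k` twos, and a single
  -- 2 is left in front of `S`.
  rw [← replicate_append_cons_self, List.replicate_add, List.append_assoc,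
    rowInsertWord_replicate_append (by decide) _ _ fun x _ => one_le, Nat.add_sub_cancel_left]

theorem rowInsertWord_replicate_one_append (a : ℕ) (V : List ℕ+) :
    rowInsertWord (List.replicate a 1 ++ V) [1, 2] =
      (List.replicate a 1 ++ (rowInsertWord V [1, 2]).1, (rowInsertWord V [1, 2]).2) :=
  rowInsertWord_append_of_le V fun y hy x _ => by
    rw [List.eq_of_mem_replicate hy]
    exact one_le

theorem rowInsertWord_replicate_two_append (b : ℕ) (S : List ℕ+) :
    rowInsertWord (List.replicate (b + 1) 2 ++ S) [1, 2] =
      (1 :: (List.replicate b 2 ++ (rowInsertWord S [2]).1), 2 :: (rowInsertWord S [2]).2) := by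
  rw [List.replicate_succ, List.cons_append,
    rowInsertWord_cons_cons_of_lt _ _ (by decide) fun x _ => one_le,
    rowInsertWord_append_of_le]
  intro y hy x hx
  rw [List.eq_of_mem_replicate hy, List.mem_singleton.1 hx]

theorem rowInsertWord_singleton_two (S : List ℕ+) (hS : ∀ x ∈ S, 2 < x) :
    rowInsertWord S [2] = (2 :: S.tail, S.head?.toList) := by
  cases S with
  | nil => rfl
  | cons s S => simp [rowInsertWord, rowInsert, hS s (by simp)]

/-! ### Commutation read off from the first two rows -/

/-- The pairs of first two rows of the tableaux of the words commuting with `12`. -/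
def RowsCommute (R S : List ℕ+) : Prop :=
  ∃ a b k : ℕ, R = List.replicate a 1 ++ List.replicate b 2 ∧ S = List.replicate k 2 ∧
    ((a = k ∧ b = 0) ∨ (k < a ∧ 0 < b))

theorem rowsCommute_of_insertion_eq {R : List ℕ+} {T : List (List ℕ+)}
    (hT : IsTableau (R :: T))
    (h1 : (rowInsertWord (1 :: 2 :: T.headD []) R).1 = (rowInsertWord R [1, 2]).1)
    (h2 : insertWord T.tail (rowInsertWord (1 :: 2 :: T.headD []) R).2 =
      insertWord T (rowInsertWord R [1, 2]).2) : RowsCommute R (T.headD []) := by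
  obtain ⟨-, hR, hRT, hT'⟩ := hT
  -- Only the second rows of the two products are needed; the default `[]` covers an absent row.
  replace h2 := congrArg (List.headD · []) h2
  simp only [headD_insertWord] at h2
  have hS : (T.headD []).Pairwise (· ≤ ·) := by
    cases T with
    | nil => simp
    | cons S T => exact hT'.2.1
  have hS2 : ∀ x ∈ T.headD [], 2 ≤ x := by
    intro x hx
    obtain ⟨j, hj⟩ := List.mem_iff_getElem?.1 hx
    obtain ⟨r, -, hr⟩ := hRT.exists_lt hj
    exact two_le_of_one_lt ((one_le).trans_lt hr)
  have hB : (rowInsertWord (1 :: 2 :: T.headD []) R).2.Pairwise (· ≤ ·) := by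
    refine List.Pairwise.sublist (sublist_rowInsertWord _ hR) ?_
    simp only [List.pairwise_cons, List.mem_cons]
    refine ⟨fun x _ => one_le, ?_, hS⟩
    exact hS2
  generalize T.headD [] = S at *
  generalize T.tail.headD [] = U at *
  obtain ⟨a, V, rfl, hV, hV1⟩ := exists_eq_replicate_append hR fun x _ => one_le
  obtain ⟨b, S₁, rfl, hS₁, hS₁2⟩ := exists_eq_replicate_append hV
    fun x hx => (two_le_of_one_lt (hV1 x hx) : (2 : ℕ+) ≤ x)
  obtain ⟨k, S₂, rfl, hS₂, hS₂2⟩ := exists_eq_replicate_append hS hS2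
  have hlen := hRT.length_le
  simp only [List.length_append, List.length_replicate] at hlen
  -- Otherwise column `a` would have a 2 in the second row below an entry greater than 1.
  have hka : k ≤ a := by
    by_contra! hak
    obtain ⟨r, hr, hr2⟩ := hRT.exists_lt (j := a) (s := 2) (by
      rw [List.getElem?_append_left (by simpa using hak)]
      simp [hak])
    rw [List.getElem?_append_right (by simp)] at hr
    have := hV1 r (List.mem_of_getElem? hr)
    exact absurd (two_le_of_one_lt this) (not_le.2 hr2)
  rw [rowInsertWord_one_two_cons _ _ _ _ hka, rowInsertWord_replicate_one_append] at h1 h2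
  rw [rowInsertWord_one_two_cons _ _ _ _ hka] at hB
  clear hRT hR hS hS2 hV1
  rcases hka.eq_or_lt with rfl | hka
  · have h2V : ∀ x ∈ List.replicate b 2 ++ S₁, 2 ≤ x := by
      intro x hx
      rcases List.mem_append.1 hx with hx | hx
      · exact (List.eq_of_mem_replicate hx).ge
      · exact (hS₁2 x hx).le
    rw [Nat.sub_self, List.replicate_zero, List.nil_append,
      rowInsertWord_cons_of_le _ _ _ h2V] at h1
    -- When k = a, write V for the part of the first row after its ones. The left row has length at
    -- least k + 2 + |V|. If V is nonempty, the inserted 1 bumps a letter on the right, whose row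
    -- then has length at most k + 1 + |V|.
    have hl := length_le_length_rowInsertWord S₂ hV
    have h1 := congrArg List.length h1
    rcases b with _ | b
    · cases S₁ with
      | nil =>
        have : S₂ = [] := by
          apply List.eq_nil_of_length_eq_zero
          simp at hlen ⊢
          exact hlen
        subst this
        exact ⟨k, 0, k, by simp, by simp, by simp⟩
      | cons s S₁ =>
        exfalso
        have hs : (1 : ℕ+) < s := lt_trans (by decide) (hS₁2 s (by simp))
        rw [List.replicate_zero, List.nil_append,
          rowInsertWord_cons_cons_of_lt _ _ hs (fun x _ => one_le),
          rowInsertWord_singleton_two _ fun x hx => hS₁2 x (by simp [hx])] at h1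
        simp at h1 hl
        omega
    · exfalso
      rw [rowInsertWord_replicate_two_append, rowInsertWord_singleton_two _ hS₁2] at h1
      simp at h1 hl
      omega
  · obtain ⟨d, rfl⟩ : ∃ d, a = k + (d + 1) := ⟨a - k - 1, by omega⟩
    rw [Nat.add_sub_cancel_left, List.replicate_succ, List.cons_append,
      rowInsertWord_cons_cons_of_lt _ _ (by decide) fun x _ => one_le] at h1 h2 hB
    have hdV : (List.replicate d 1 ++ (List.replicate b 2 ++ S₁)).Pairwise (· ≤ ·) := by
      rw [List.pairwise_append]
      refine ⟨List.pairwise_replicate.2 (Or.inr le_rfl), hV, ?_⟩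
      intro x hx y _
      rw [List.eq_of_mem_replicate hx]
      exact one_le
    have hl := length_le_length_rowInsertWord S₂ hdV
    have hc := length_rowInsertWord S₂ (List.replicate d 1 ++ (List.replicate b 2 ++ S₁))
    have h1' := congrArg List.length h1
    rcases b with _ | b
    -- The right row contains the inserted 2, whereas on the left all twos have been bumped.
    · exfalso
      have hm : (2 : ℕ+) ∈ (rowInsertWord (List.replicate 0 2 ++ S₁) [1, 2]).1 :=
        mem_rowInsert 2 _
      have hm := List.mem_append_right (List.replicate (k + (d + 1)) 1) hm
      dsimp only at h1
      rw [← h1] at hm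
      simp only [List.mem_cons, List.mem_append, List.mem_replicate] at hm
      rcases hm with hm | ⟨-, hm⟩ | hm | hm
      · exact absurd hm (by decide)
      · exact absurd hm (by decide)
      · exact absurd hm (by decide)
      · rcases mem_of_mem_rowInsertWord hm with hm | hm
        · exact lt_irrefl _ (hS₂2 2 hm)
        · simp only [List.replicate_zero, List.nil_append, List.mem_append,
            List.mem_replicate] at hm
          rcases hm with ⟨-, hm⟩ | hm
          · exact absurd hm (by decide)
          · exact lt_irrefl _ (hS₁2 2 hm)
    · rw [rowInsertWord_replicate_two_append, rowInsertWord_singleton_two _ hS₁2] at h1' h2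
      cases S₁ with
      | cons s S₁ =>
        -- Here both 1 and 2 bump a letter of the first row, so the right row keeps its length,
        -- while the left row is longer by at least one.
        exfalso
        simp at h1' hl
        omega
      | nil =>
        cases S₂ with
        | nil => exact ⟨k + (d + 1), b + 1, k, by simp, by simp, by omega⟩
        | cons s S₂ =>
          -- Equality of the first rows forces as many letters out of S₂ as it has. With the k + 1
          -- bumped twos they form a weakly increasing word, so the left second row has length at
          -- least k + 1 + |S₂|. On the right, the 2 bumps the first letter of S₂, and the second
          -- row keeps its length k + |S₂|.
          exfalso
          have h2k : ∀ y ∈ List.replicate k (2 : ℕ+), ∀ x ∈ [(2 : ℕ+)], y ≤ x := by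
            intro y hy x hx
            rw [List.eq_of_mem_replicate hy, List.mem_singleton.1 hx]
          have hU := length_le_length_rowInsertWord U hB
          have h2' := congrArg List.length h2
          dsimp only [List.head?_nil, Option.toList_none] at h2'
          rw [rowInsertWord_append_of_le _ h2k, rowInsertWord_singleton_two _ hS₂2] at h2'
          simp at h1' h2' hU hc
          omega

theorem insertion_eq_of_rowsCommute {R : List ℕ+} {T : List (List ℕ+)}
    (hT : IsTableau (R :: T)) (h : RowsCommute R (T.headD [])) :
    (rowInsertWord (1 :: 2 :: T.headD []) R).1 = (rowInsertWord R [1, 2]).1 ∧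
      insertWord T.tail (rowInsertWord (1 :: 2 :: T.headD []) R).2 =
        insertWord T (rowInsertWord R [1, 2]).2 := by
  obtain ⟨a, b, k, rfl, hk, h⟩ := h
  have hT' : IsTableau T := hT.2.2.2
  have hka : k ≤ a := by omega
  have e := rowInsertWord_one_two_cons a k [] (List.replicate b 2) hka
  rw [List.append_nil, ← hk] at e
  rw [e, rowInsertWord_replicate_one_append]
  rcases h with ⟨rfl, rfl⟩ | ⟨hka, hb⟩
  · simp only [Nat.sub_self, List.replicate_zero, List.append_nil]
    constructor
    · rw [← List.cons_append, ← List.replicate_succ, List.replicate_succ']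
      simp [rowInsertWord, rowInsert]
    -- The word bumped on the left is the first row of `T` itself, so reinserting it into the
    -- remaining rows restores `T`.
    · rw [show (rowInsertWord [] [1, 2]).2 = ([] : List ℕ+) from rfl,
        show (rowInsertWord [2] []).2 = ([] : List ℕ+) from rfl, List.append_nil]
      cases T with
      | nil => rfl
      | cons S T => exact hT'.insertWord_eq
  · obtain ⟨d, rfl⟩ : ∃ d, a = k + (d + 1) := ⟨a - k - 1, by omega⟩
    obtain ⟨b, rfl⟩ : ∃ c, b = c + 1 := ⟨b - 1, by omega⟩
    have hV : (List.replicate d (1 : ℕ+) ++ List.replicate (b + 1) 2).Pairwise (· ≤ ·) := by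
      rw [List.pairwise_append]
      refine ⟨List.pairwise_replicate.2 (Or.inr le_rfl),
        List.pairwise_replicate.2 (Or.inr le_rfl), ?_⟩
      intro x hx y _
      rw [List.eq_of_mem_replicate hx]
      exact one_le
    have e2 := rowInsertWord_replicate_two_append b []
    rw [List.append_nil] at e2
    rw [e2, Nat.add_sub_cancel_left, List.replicate_succ, List.cons_append,
      rowInsertWord_cons_cons_of_lt _ _ (by decide) fun x _ => one_le,
      rowInsertWord_nil_left hV, rowInsertWord_singleton_two _ (by simp)]
    constructor
    · simp only [List.tail_nil]
      rw [replicate_append_cons_self (k + (d + 1))]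
      simp [List.replicate_add, List.replicate_succ, replicate_append_cons_self b]
    -- On the right a single 2 is bumped, and it extends the row 2^k of `T`. The result is a tableau
    -- with first row 2^(k+1), which is exactly the word bumped on the left, so reinserting that row
    -- produces the same tableau.
    · have h2 := hT'.tableauInsert 2
      have h3 : tableauInsert 2 T = (List.replicate k 2 ++ [2]) :: T.tail := by
        cases T with
        | nil =>
          have : k = 0 := by simpa using hk.symm
          subst this
          rfl
        | cons S T =>
          obtain rfl : S = List.replicate k 2 := hk
          have : rowInsert 2 (List.replicate k (2 : ℕ+)) = (List.replicate k 2 ++ [2], none) := by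
            rcases rowInsert_spec 2 (List.replicate k (2 : ℕ+)) with ⟨-, h⟩ | ⟨A, z, B, h, -, hz, -⟩
            · exact h
            · have : z ∈ List.replicate k (2 : ℕ+) := by simp [h]
              exact absurd hz (by rw [List.eq_of_mem_replicate this]; exact lt_irrefl _)
          rw [tableauInsert, this]
          rfl
      rw [h3] at h2
      have h4 := h2.insertWord_eq
      rw [← h3, ← hk] at h4
      exact h4

theorem mem_centralizer_one_two_iff {w R : List ℕ+} {T : List (List ℕ+)}
    (h : insertionTableau w = R :: T) :
    w ∈ centralizer ([1, 2] : List ℕ+) ↔ RowsCommute R (T.headD []) := by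
  have hT : IsTableau (R :: T) := h ▸ isTableau_insertionTableau w
  rw [centralizer, Set.mem_ofPred_eq, knuthEquiv_iff, insertionTableau_one_two_append h,
    insertionTableau_append_one_two h, List.cons.injEq]
  exact ⟨fun h => rowsCommute_of_insertion_eq hT h.1 h.2, insertion_eq_of_rowsCommute hT⟩

/-! ### From rows to columns -/

theorem column_cons {α : Type*} (R : List α) (T : List (List α)) (j : ℕ) :
    column (R :: T) j = R[j]?.toList ++ column T j := by
  rw [column, List.filterMap_cons]
  cases R[j]? <;> rfl

theorem IsTableau.exists_lt_of_mem_column {α : Type*} [LinearOrder α] {R : List α}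
    {T : List (List α)} (h : IsTableau (R :: T)) {j : ℕ} {x : α} (hx : x ∈ column T j) :
    ∃ r, R[j]? = some r ∧ r < x := by
  induction T generalizing R with
  | nil => simp [column] at hx
  | cons S T ih =>
    obtain ⟨-, -, hRS, hT⟩ := h
    have hRS : ColumnStrict R S := hRS
    rw [column_cons, List.mem_append, Option.mem_toList] at hx
    rcases hx with hx | hx
    · exact hRS.exists_lt hx
    · obtain ⟨s, hs, hsx⟩ := ih hT hx
      obtain ⟨r, hr, hrs⟩ := hRS.exists_lt hs
      exact ⟨r, hr, hrs.trans hsx⟩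

theorem IsTableau.column_eq_nil {α : Type*} [LinearOrder α] {T : List (List α)}
    (h : IsTableau T) {j : ℕ} (hj : (T.headD []).length ≤ j) : column T j = [] := by
  cases T with
  | nil => rfl
  | cons R T =>
    have hR : R[j]? = none := List.getElem?_eq_none hj
    rw [column_cons, hR, Option.toList_none, List.nil_append, List.eq_nil_iff_forall_not_mem]
    intro x hx
    obtain ⟨r, hr, -⟩ := h.exists_lt_of_mem_column hx
    simp [hR] at hr

theorem mem_columns_cons {α : Type*} {R : List α} {T : List (List α)} {C : List α} :
    C ∈ columns (R :: T) ↔ ∃ j, ∃ h : j < R.length, C = R[j] :: column T j := by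
  simp only [columns, List.headD_cons, List.mem_map, List.mem_range]
  constructor
  · rintro ⟨j, hj, rfl⟩
    exact ⟨j, hj, by simp [column_cons, hj]⟩
  · rintro ⟨j, hj, rfl⟩
    exact ⟨j, hj, by simp [column_cons, hj]⟩

theorem two_le_length_iff {α : Type*} [LinearOrder α] {T : List (List α)}
    (hT : IsTableau T) {a : α} {j : ℕ} :
    2 ≤ (a :: column T j).length ↔ j < (T.headD []).length := by
  constructor
  · intro h
    by_contra! hj
    rw [hT.column_eq_nil hj] at h
    simp at h
  · intro h
    cases T with
    | nil => simp at h
    | cons S T =>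
      have h : j < S.length := h
      simp [column_cons, h]

/-- Columns increase strictly and their entries are positive, so 1 can only be the top entry and 2
then only the one below it. -/
theorem one_two_mem_column_iff {R : List ℕ+} {T : List (List ℕ+)} (hT : IsTableau (R :: T))
    {j : ℕ} (hj : j < R.length) (hj' : j < (T.headD []).length) :
    (1 ∈ R[j] :: column T j ∧ 2 ∈ R[j] :: column T j) ↔ R[j] = 1 ∧ (T.headD [])[j] = 2 := by
  cases T with
  | nil => simp at hj'
  | cons S T =>
    have hj' : j < S.length := hj'
    change _ ↔ R[j] = 1 ∧ S[j] = 2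
    have hc : column (S :: T) j = S[j] :: column T j := by simp [column_cons, hj']
    constructor
    · rintro ⟨h1, h2⟩
      have key : ∀ x ∈ column (S :: T) j, R[j] < x := by
        intro x hx
        obtain ⟨r, hr, hrx⟩ := hT.exists_lt_of_mem_column hx
        rw [List.getElem?_eq_getElem hj, Option.some_inj] at hr
        rwa [hr]
      have hR : R[j] = 1 := by
        rcases List.mem_cons.1 h1 with h1 | h1
        · exact h1.symm
        · exact absurd (key 1 h1) (not_lt.2 one_le)
      refine ⟨hR, ?_⟩
      rw [hR, List.mem_cons, hc, List.mem_cons] at h2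
      rcases h2 with h2 | h2 | h2
      · exact absurd h2 (by decide)
      · exact h2.symm
      · obtain ⟨s, hs, hs2⟩ := hT.2.2.2.exists_lt_of_mem_column h2
        rw [List.getElem?_eq_getElem hj', Option.some_inj] at hs
        have h1S := two_le_of_one_lt (hR ▸ key S[j] (by simp [hc]))
        rw [hs] at h1S
        exact absurd hs2 (not_lt.2 h1S)
    · rintro ⟨h1, h2⟩
      simp [hc, h1, h2]

theorem column_conditions_iff {R : List ℕ+} {T : List (List ℕ+)} (hT : IsTableau (R :: T)) :
    (((∃ C ∈ columns (R :: T), C.length = 1) →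
        (∀ C ∈ columns (R :: T), C.length = 1 →
          IsSingletonColumn 1 C ∨ IsSingletonColumn 2 C) ∧
        (∃ C ∈ columns (R :: T), IsSingletonColumn 1 C) ∧
        (∃ C ∈ columns (R :: T), IsSingletonColumn 2 C)) ∧
      (∀ C ∈ columns (R :: T), 2 ≤ C.length → 1 ∈ C ∧ 2 ∈ C)) ↔
    RowsCommute R (T.headD []) := by
  have hle : (T.headD []).length ≤ R.length := hT.2.2.1.length_le
  have hnil : ∀ {j}, (T.headD []).length ≤ j → column T j = [] := hT.2.2.2.column_eq_nil
  have hlen : ∀ {j} {a : ℕ+}, 2 ≤ (a :: column T j).length ↔ j < (T.headD []).length :=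
    two_le_length_iff hT.2.2.2
  have hlen1 : ∀ {j} {a : ℕ+}, (a :: column T j).length = 1 ↔ (T.headD []).length ≤ j := by
    intro j a
    rw [← not_lt, ← hlen (a := a), List.length_cons]
    omega
  have hmem : ∀ {j} (hj : j < R.length), R[j] :: column T j ∈ columns (R :: T) :=
    fun hj => mem_columns_cons.2 ⟨_, hj, rfl⟩
  constructor
  · rintro ⟨ha, hb⟩
    have hb' : ∀ j (hj : j < (T.headD []).length), R[j] = 1 ∧ (T.headD [])[j] = 2 :=
      fun j hj => (one_two_mem_column_iff hT (hj.trans_le hle) hj).1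
        (hb _ (hmem (hj.trans_le hle)) (hlen.2 hj))
    have hS : T.headD [] = List.replicate (T.headD []).length 2 := by
      rw [List.eq_replicate_iff]
      refine ⟨rfl, fun x hx => ?_⟩
      obtain ⟨j, hj, rfl⟩ := List.mem_iff_getElem.1 hx
      exact (hb' j hj).2
    rcases hle.eq_or_lt with hl | hl
    -- The two rows are equally long, so every column has length at least 2 and begins with 1.
    · refine ⟨R.length, 0, _, ?_, hS, Or.inl ⟨hl.symm, rfl⟩⟩
      rw [List.replicate_zero, List.append_nil, List.eq_replicate_iff]
      refine ⟨rfl, fun x hx => ?_⟩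
      obtain ⟨j, hj, rfl⟩ := List.mem_iff_getElem.1 hx
      exact (hb' j (hl ▸ hj)).1
    · obtain ⟨ha, ⟨C₁, hC₁, h₁⟩, ⟨C₂, hC₂, h₂⟩⟩ := ha ⟨_, hmem hl, hlen1.2 le_rfl⟩
      have h12 : ∀ x ∈ R, x = 1 ∨ x = 2 := by
        intro x hx
        obtain ⟨j, hj, rfl⟩ := List.mem_iff_getElem.1 hx
        rcases lt_or_ge j (T.headD []).length with hj' | hj'
        · exact Or.inl (hb' j hj').1
        · have := ha _ (hmem hj) (hlen1.2 hj')
          rw [hnil hj'] at this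
          simpa [IsSingletonColumn] using this
      obtain ⟨a, V, hRV, hV, hV1⟩ := exists_eq_replicate_append hT.2.1 (x := 1)
        fun x _ => one_le
      have hV2 : V = List.replicate V.length 2 := by
        rw [List.eq_replicate_iff]
        refine ⟨rfl, fun x hx => ?_⟩
        exact (h12 x (by simp [hRV, hx])).resolve_left (hV1 x hx).ne'
      refine ⟨a, V.length, _, by rw [← hV2]; exact hRV, hS, Or.inr ⟨?_, ?_⟩⟩
      · obtain ⟨j, hj, rfl⟩ := mem_columns_cons.1 hC₁
        rw [IsSingletonColumn, List.cons.injEq] at h₁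
        have hj' : (T.headD []).length ≤ j := (hlen1 (a := 1)).1 (by simp [h₁.2])
        refine hj'.trans_lt ?_
        by_contra! haj
        have hjV : R[j] ∈ V := by
          have : R[j]? = V[j - a]? := by
            rw [hRV, List.getElem?_append_right (by simpa using haj), List.length_replicate]
          rw [List.getElem?_eq_getElem hj] at this
          exact List.mem_of_getElem? this.symm
        exact (hV1 _ hjV).ne' h₁.1
      · obtain ⟨j, hj, rfl⟩ := mem_columns_cons.1 hC₂
        rw [IsSingletonColumn, List.cons.injEq] at h₂
        rw [List.length_pos_iff]
        rintro rfl
        have h2 : (2 : ℕ+) ∈ R := h₂.1 ▸ List.getElem_mem hj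
        rw [hRV, List.append_nil] at h2
        exact absurd (List.eq_of_mem_replicate h2) (by decide)
  · rintro ⟨a, b, k, hR, hS, h⟩
    have hk : (T.headD []).length = k := by rw [hS, List.length_replicate]
    have hka : k ≤ a := by omega
    have hab : R.length = a + b := by simp [hR]
    have hR1 : ∀ j (hj : j < R.length), j < a → R[j] = 1 := by
      intro j hj hja
      simp only [hR]
      rw [List.getElem_append_left (by simpa using hja), List.getElem_replicate]
    have hR2 : ∀ j (hj : j < R.length), a ≤ j → R[j] = 2 := by
      intro j hj hja
      simp only [hR]
      rw [List.getElem_append_right (by simpa using hja), List.getElem_replicate]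
    constructor
    · rintro ⟨C, hC, hC1⟩
      obtain ⟨j, hj, rfl⟩ := mem_columns_cons.1 hC
      have hkj := hlen1.1 hC1
      obtain ⟨hka', hb⟩ : k < a ∧ 0 < b := by omega
      -- Column `k` is the first one beyond the second row, and its entry is 1 because k < a; column
      -- `a` carries the first 2 of `R`.
      refine ⟨?_, ⟨_, hmem (j := k) (by omega), ?_⟩, ⟨_, hmem (j := a) (by omega), ?_⟩⟩
      · intro C hC hC1
        obtain ⟨i, hi, rfl⟩ := mem_columns_cons.1 hC
        rw [hnil (hlen1.1 hC1)]
        rcases lt_or_ge i a with hia | hia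
        · exact Or.inl (by rw [hR1 i hi hia]; rfl)
        · exact Or.inr (by rw [hR2 i hi hia]; rfl)
      · rw [hnil hk.le, hR1 k _ hka']
        rfl
      · rw [hnil (by omega), hR2 a _ le_rfl]
        rfl
    · intro C hC hC2
      obtain ⟨j, hj, rfl⟩ := mem_columns_cons.1 hC
      have hj' := hlen.1 hC2
      refine (one_two_mem_column_iff hT hj hj').2 ⟨hR1 j hj (by omega), ?_⟩
      simp only [hS, List.getElem_replicate]

end Plactic

theorem theoremC (w : List ℕ+) :
    w ∈ Plactic.centralizer ([1, 2] : List ℕ+) ↔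
      ((∃ C ∈ Plactic.columns (Plactic.insertionTableau w), C.length = 1) →
        (∀ C ∈ Plactic.columns (Plactic.insertionTableau w), C.length = 1 →
          Plactic.IsSingletonColumn 1 C ∨ Plactic.IsSingletonColumn 2 C) ∧
        (∃ C ∈ Plactic.columns (Plactic.insertionTableau w), Plactic.IsSingletonColumn 1 C) ∧
        (∃ C ∈ Plactic.columns (Plactic.insertionTableau w), Plactic.IsSingletonColumn 2 C)) ∧
      (∀ C ∈ Plactic.columns (Plactic.insertionTableau w), 2 ≤ C.length → 1 ∈ C ∧ 2 ∈ C) := by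
  have hT := Plactic.isTableau_insertionTableau w
  rcases h : Plactic.insertionTableau w with _ | ⟨R, T⟩
  -- With an empty tableau, `w` is equivalent to the empty word, which is central, and there are no
  -- columns to test.
  · have h1 := Plactic.knuthEquiv_rowReading_insertionTableau w
    rw [h, Plactic.rowReading_nil] at h1
    have h2 : w ∈ Plactic.centralizer ([1, 2] : List ℕ+) :=
      (h1.append_left [1, 2]).trans (h1.append_right [1, 2]).symm
    simp [h2, Plactic.columns]
  · rw [h] at hT
    rw [Plactic.mem_centralizer_one_two_iff h, Plactic.column_conditions_iff hT]
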